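/- Let $I$ be a set (typically infinite) and, for each $i\in I$, let $H_i$ be a complex Hilbert space, $G_i$ a group (with no topology) and $\pi_i:G_i\to U(\mathcal L(H_i))$ a unitary representation. Let $\bigotimes_{i\in I}H_i$ be the algebraic infinite tensor product (the universal vector space for maps on $\prod_i H_i$ that are linear in each variable), with elementary tensors $\otimes_i x_i$. For $\beta\in\mathbb C^I$ put $\varphi_1(\beta)=\prod_i\beta_i$ if $\beta_i=1$ for all but finitely many $i$, and $\varphi_1(\beta)=0$ otherwise; put $\varphi_0(\beta)=\prod_i\beta_i$ if $\sum_i|\beta_i-1|<\infty$, and $\varphi_0(\beta)=0$ otherwise. Let $\bar\bigotimes^{\phi_1}_{i\in I}H_i$ be the Hilbert space completion of the linear span in $\bigotimes_{i\in I}H_i$ of all $\otimes_i x_i$ with $\|x_i\|=1$ for every $i$, for the inner product determined by $\langle\otimes_i x_i,\otimes_i y_i\rangle=\varphi_1\big((\langle x_i,y_i\rangle)_i\big)$. Let $\prod\otimes_{i\in I}H_i$ be von Neumann's infinite direct product: the Hilbert space generated by vectors $\prod\otimes_i x_i$, one for each $C_0$-sequence $x$ (that is, $x\in\prod_iH_i$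 with $\sum_i\big|\|x_i\|-1\big|<\infty$), with $\langle\prod\otimes_i x_i,\prod\otimes_i y_i\rangle=\varphi_0\big((\langle x_i,y_i\rangle)_i\big)$. (a) There is a unique unitary representation $\bigotimes^{\phi_1}_{i\in I}\pi_i$ of the group $\prod_{i\in I}G_i$ on $\bar\bigotimes^{\phi_1}_{i\in I}H_i$ such that $$\Big(\bigotimes\nolimits^{\phi_1}_{i\in I}\pi_i\Big)(t)\,(\otimes_i x_i)=\otimes_i\,\pi_i(t_i)x_i$$ for all $t\in\prod_iG_i$ and all families $(x_i)$ of unit vectors; and there is a unique unitary representation $\prod\otimes_{i\in I}\,\pi_i$ of $\prod_{i\in I}G_i$ on $\prod\otimes_{i\in I}H_i$ such that $$\Big(\prod\otimes_{i\in I}\,\pi_i\Big)(t)\,\big(\prod\otimes_i x_i\big)=\prod\otimes_i\,\pi_i(t_i)x_i$$ for all $t\in\prod_iG_i$ and all $C_0$-sequences $x$. (b) If for every $i\in I$ the $^*$-representation $\hat\pi_i:\mathbb C[G_i]\to\mathcal L(H_i)$ of the group algebra induced by $\pi_i$ is injective, then the $^*$-representation of $\mathbb C\big[\prod_{i\in I}G_i\big]$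 on $\bar\bigotimes^{\phi_1}_{i\in I}H_i$ induced by $\bigotimes^{\phi_1}_{i\in I}\pi_i$ is injective. -/

import Mathlib

open scoped TensorProduct ComplexConjugate ComplexOrder
open Filter Topology

noncomputable section

namespace InfTensor

universe u v w

/-! ### The multilinear functionals `φ₁` and `φ₀` on families of complex numbers -/

section Phi

variable {I : Type u}

open Classical in
/-- `φ₁(β) = ∏ i, β i` if `β i = 1` for all but finitely many `i`, and `φ₁(β) = 0` otherwise. -/
def phi1Fun (β : I → ℂ) : ℂ :=
  if (Function.mulSupport β).Finite then ∏ᶠ i, β i else 0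

open Classical in
/-- `φ₀(β) = ∏ i, β i` (limit of the finite partial products) if `∑ |β i - 1| < ∞`,
and `φ₀(β) = 0` otherwise. -/
def phi0Fun (β : I → ℂ) : ℂ :=
  if Summable (fun i => ‖β i - 1‖) then ∏' i, β i else 0

theorem mulSupport_update_finite_iff [DecidableEq I] (m : I → ℂ) (i : I) (x : ℂ) :
    (Function.mulSupport (Function.update m i x)).Finite ↔ (Function.mulSupport m).Finite := by
  constructor
  · intro h
    refine (h.insert i).subset fun j hj => ?_
    by_cases hji : j = i
    · exact Or.inl hji
    · right
      simpa [Function.mem_mulSupport, Function.update_of_ne hji] using hj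
  · intro h
    refine (h.insert i).subset fun j hj => ?_
    by_cases hji : j = i
    · exact Or.inl hji
    · right
      simpa [Function.mem_mulSupport, Function.update_of_ne hji] using hj

theorem phi1Fun_update [DecidableEq I] (m : I → ℂ) (i : I) (x : ℂ) :
    phi1Fun (Function.update m i x) = x * phi1Fun (Function.update m i 1) := by
  by_cases h : (Function.mulSupport m).Finite
  · have hx := (mulSupport_update_finite_iff m i x).2 h
    have h1 := (mulSupport_update_finite_iff m i 1).2 h
    have hs : ∀ y : ℂ, Function.mulSupport (Function.update m i y) ⊆
        ((insert i h.toFinset : Finset I) : Set I) := by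
      intro y j hj
      by_cases hji : j = i
      · simp [hji]
      · have : m j ≠ 1 := by
          simpa [Function.mem_mulSupport, Function.update_of_ne hji] using hj
        simp [hji, this]
    rw [phi1Fun, phi1Fun, if_pos hx, if_pos h1,
      finprod_eq_prod_of_mulSupport_subset _ (hs x), finprod_eq_prod_of_mulSupport_subset _ (hs 1),
      Finset.prod_update_of_mem (by simp), Finset.prod_update_of_mem (by simp), one_mul]
  · have hx := mt (mulSupport_update_finite_iff m i x).1 h
    have h1 := mt (mulSupport_update_finite_iff m i 1).1 h
    rw [phi1Fun, phi1Fun, if_neg hx, if_neg h1, mul_zero]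

/-- The multilinear map `φ₁ : ∏ ℂ → ℂ`. -/
def phi1Multilinear (I : Type u) : MultilinearMap ℂ (fun _ : I => ℂ) ℂ where
  toFun := phi1Fun
  map_update_add' m i x y := by
    rw [phi1Fun_update m i (x + y), phi1Fun_update m i x, phi1Fun_update m i y, add_mul]
  map_update_smul' m i c x := by
    rw [phi1Fun_update m i (c • x), phi1Fun_update m i x, smul_eq_mul, smul_eq_mul, mul_assoc]

/-- The linear functional `φ₁` on the algebraic infinite tensor product `⨂ ℂ`. -/
def phi1 (I : Type u) : (⨂[ℂ] _ : I, ℂ) →ₗ[ℂ] ℂ :=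
  PiTensorProduct.lift (phi1Multilinear I)

theorem phi1Fun_conj (β : I → ℂ) : phi1Fun (fun i => conj (β i)) = conj (phi1Fun β) := by
  have hs : Function.mulSupport (fun i => conj (β i)) = Function.mulSupport β := by
    ext i
    have h1 : conj (β i) = 1 ↔ β i = 1 := by
      rw [← (starRingEnd ℂ).injective.eq_iff (a := β i), map_one]
    simp [Function.mem_mulSupport, h1]
  unfold phi1Fun
  rw [hs]
  split_ifs with h
  · rw [finprod_eq_prod_of_mulSupport_subset (s := h.toFinset) _ (by rw [hs]; simp),
      finprod_eq_prod_of_mulSupport_subset (s := h.toFinset) _ (by simp), map_prod]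
  · simp

theorem multipliable_of_summable_norm_sub_one {β : I → ℂ}
    (h : Summable (fun i => ‖β i - 1‖)) : Multipliable β := by
  have := multipliable_one_add_of_summable (f := fun i => β i - 1) h
  simpa using this

theorem phi0Fun_conj (β : I → ℂ) : phi0Fun (fun i => conj (β i)) = conj (phi0Fun β) := by
  have hs : (fun i => ‖conj (β i) - 1‖) = fun i => ‖β i - 1‖ := by
    funext i
    rw [← RCLike.norm_conj (β i - 1)]
    simp
  unfold phi0Fun
  rw [hs]
  split_ifs with h
  · exact ((multipliable_of_summable_norm_sub_one h).map_tprod (starRingEnd ℂ)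
      Complex.continuous_conj).symm
  · simp

end Phi

/-! ### Positivity of kernels that are limits of finite products of inner products -/

section Kernel

variable {I : Type u} {H : I → Type v} [∀ i, NormedAddCommGroup (H i)]
  [∀ i, InnerProductSpace ℂ (H i)]

theorem posSemidef_gram_any {X : Type w} {E : Type v} [NormedAddCommGroup E]
    [InnerProductSpace ℂ E] (f : X → E) :
    (Matrix.of fun x y => inner ℂ (f x) (f y) : Matrix X X ℂ).PosSemidef := by
  refine ⟨Matrix.ext fun x y => by simp, fun c => ?_⟩
  have : (c.sum fun x a => c.sum fun y b => star a * (Matrix.of fun x y =>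
      inner ℂ (f x) (f y) : Matrix X X ℂ) x y * b) =
      inner ℂ (c.sum fun x a => a • f x) (c.sum fun x a => a • f x) := by
    simp only [Finsupp.sum, sum_inner, inner_sum, inner_smul_left, inner_smul_right,
      Matrix.of_apply, RCLike.star_def]
    simp only [Finset.mul_sum]
    rw [Finset.sum_comm]
    refine Finset.sum_congr rfl fun x _ => Finset.sum_congr rfl fun y _ => ?_
    ring
  rw [this, inner_self_eq_norm_sq_to_K]
  positivity

theorem posSemidef_prod_inner {X : Type w} (f : X → ∀ i, H i) (F : Finset I) :
    (Matrix.of fun x y => ∏ i ∈ F, inner ℂ (f x i) (f y i) : Matrix X X ℂ).PosSemidef := by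
  classical
  induction F using Finset.induction_on with
  | empty =>
    simpa using posSemidef_gram_any (fun _ : X => (1 : ℂ))
  | insert i F hi ih =>
    have e : (Matrix.of fun x y => ∏ j ∈ insert i F, inner ℂ (f x j) (f y j) : Matrix X X ℂ) =
        Matrix.hadamard (Matrix.of fun x y => inner ℂ (f x i) (f y i))
          (Matrix.of fun x y => ∏ j ∈ F, inner ℂ (f x j) (f y j)) := by
      ext x y
      simp [Finset.prod_insert hi]
    rw [e]
    exact (posSemidef_gram_any (fun x => f x i)).hadamard ih

theorem posSemidef_kernel {X : Type w} (f : X → ∀ i, H i) (r : Setoid X) (K : Matrix X X ℂ)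
    (h0 : ∀ x y, ¬ r x y → K x y = 0)
    (h1 : ∀ x y, r x y →
      Tendsto (fun F : Finset I => ∏ i ∈ F, inner ℂ (f x i) (f y i)) atTop (𝓝 (K x y))) :
    K.PosSemidef := by
  classical
  let J : Matrix X X ℂ := (1 : Matrix (Quotient r) (Quotient r) ℂ).submatrix
    (Quotient.mk r) (Quotient.mk r)
  let P : Finset I → Matrix X X ℂ := fun F =>
    Matrix.hadamard J (Matrix.of fun x y => ∏ i ∈ F, inner ℂ (f x i) (f y i))
  have hP : ∀ F, (P F).PosSemidef := fun F =>
    (Matrix.PosSemidef.one.submatrix _).hadamard (posSemidef_prod_inner f F)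
  have hlim : ∀ x y, Tendsto (fun F => P F x y) atTop (𝓝 (K x y)) := by
    intro x y
    by_cases h : r x y
    · have hJ : J x y = 1 := by
        have : (Quotient.mk r x) = Quotient.mk r y := Quotient.sound h
        change (1 : Matrix (Quotient r) (Quotient r) ℂ) (Quotient.mk r x) (Quotient.mk r y) = 1
        rw [this, Matrix.one_apply_eq]
      simpa [P, hJ] using h1 x y h
    · have hJ : J x y = 0 := by
        have : (Quotient.mk r x) ≠ Quotient.mk r y := fun e => h (Quotient.exact e)
        simp only [J, Matrix.submatrix_apply, Matrix.one_apply_ne this]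
      simp [P, hJ, h0 x y h]
  refine ⟨Matrix.ext fun x y => ?_, fun c => ?_⟩
  · have h2 : Tendsto (fun F => P F x y) atTop (𝓝 (star (K y x))) := by
      have := (hlim y x).star
      refine this.congr fun F => ?_
      have := congrFun (congrFun (hP F).1 x) y
      simpa using this
    simpa using tendsto_nhds_unique h2 (hlim x y)
  · refine ge_of_tendsto' (x := atTop) (f := fun F : Finset I =>
      c.sum fun x a => c.sum fun y b => star a * P F x y * b) ?_ fun F => (hP F).2 c
    simp only [Finsupp.sum]
    refine tendsto_finsetSum _ fun x _ => tendsto_finsetSum _ fun y _ => ?_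
    exact ((hlim x y).const_mul _).mul_const _

end Kernel

/-! ### The Hilbert space `⨂̄^{φ₁} H i` -/

section Phi1Tensor

variable {I : Type u} (H : I → Type v) [∀ i, NormedAddCommGroup (H i)]
  [∀ i, InnerProductSpace ℂ (H i)]

variable {H} in
/-- Auxiliary multilinear map: the conjugate of `y ↦ φ₁(⟨⨂ y i, η⟩)`. -/
def phi1FormAux (η : ⨂[ℂ] i, H i) : MultilinearMap ℂ H ℂ where
  toFun y := conj (phi1 I (PiTensorProduct.map (fun i => innerₛₗ ℂ (y i)) η))
  map_update_add' y i a b := by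
    have h : ∀ z : H i, (fun j => innerₛₗ ℂ (Function.update y i z j)) =
        Function.update (fun j => innerₛₗ ℂ (y j)) i (innerₛₗ ℂ z) := by
      intro z
      funext j
      by_cases hj : j = i
      · subst hj; simp
      · simp [Function.update_of_ne hj]
    rw [h, h, h, map_add, PiTensorProduct.map_update_add]
    simp
  map_update_smul' y i c a := by
    have h : ∀ z : H i, (fun j => innerₛₗ ℂ (Function.update y i z j)) =
        Function.update (fun j => innerₛₗ ℂ (y j)) i (innerₛₗ ℂ z) := by
      intro z
      funext j
      by_cases hj : j = i
      · subst hj; simp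
      · simp [Function.update_of_ne hj]
    rw [h, h, map_smulₛₗ, PiTensorProduct.map_update_smul]
    simp

variable {H} in
/-- The sesquilinear form `⟨ξ, η⟩_{φ₁}` on the algebraic infinite tensor product
(conjugate linear in `ξ`, linear in `η`); see `phi1Form_tprod`. -/
def phi1Form (ξ η : ⨂[ℂ] i, H i) : ℂ :=
  conj (PiTensorProduct.lift (phi1FormAux η) ξ)

theorem phi1Form_tprod (x y : ∀ i, H i) :
    phi1Form (PiTensorProduct.tprod ℂ x) (PiTensorProduct.tprod ℂ y) =
      phi1 I (PiTensorProduct.tprod ℂ fun i => inner ℂ (x i) (y i)) := by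
  simp [phi1Form, phi1FormAux]

theorem phi1_tprod (β : I → ℂ) : phi1 I (PiTensorProduct.tprod ℂ β) = phi1Fun β := by
  simp [phi1, phi1Multilinear]

variable {H}

theorem phi1Form_add_left (ξ ξ' η : ⨂[ℂ] i, H i) :
    phi1Form (ξ + ξ') η = phi1Form ξ η + phi1Form ξ' η := by
  simp [phi1Form]

theorem phi1Form_smul_left (c : ℂ) (ξ η : ⨂[ℂ] i, H i) :
    phi1Form (c • ξ) η = conj c * phi1Form ξ η := by
  simp [phi1Form]

theorem phi1Form_conj_symm (ξ η : ⨂[ℂ] i, H i) : conj (phi1Form η ξ) = phi1Form ξ η := by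
  have hadd : ∀ ζ η η' : ⨂[ℂ] i, H i,
      phi1Form ζ (η + η') = phi1Form ζ η + phi1Form ζ η' := by
    intro ζ η η'
    induction ζ using PiTensorProduct.induction_on with
    | smul_tprod r x =>
      simp only [phi1Form_smul_left]
      simp [phi1Form, phi1FormAux, mul_add]
    | add a b ha hb => simp only [phi1Form_add_left, ha, hb]; ring
  have hsmul : ∀ (ζ : ⨂[ℂ] i, H i) (c : ℂ) (η : ⨂[ℂ] i, H i),
      phi1Form ζ (c • η) = c * phi1Form ζ η := by
    intro ζ c η
    induction ζ using PiTensorProduct.induction_on with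
    | smul_tprod r x =>
      simp only [phi1Form_smul_left]
      simp [phi1Form, phi1FormAux]
      ring
    | add a b ha hb => simp only [phi1Form_add_left, ha, hb]; ring
  induction ξ using PiTensorProduct.induction_on with
  | smul_tprod r x =>
    induction η using PiTensorProduct.induction_on with
    | smul_tprod s y =>
      simp only [phi1Form_smul_left, hsmul, phi1Form_tprod, phi1_tprod, map_mul,
        ← phi1Fun_conj, inner_conj_symm, Complex.conj_conj]
      ring
    | add a b ha hb => rw [phi1Form_add_left, map_add, ha, hb, hadd]
  | add a b ha hb => rw [hadd, map_add, ha, hb, phi1Form_add_left]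

theorem phi1Form_sum_left {J : Type w} (s : Finset J) (a : J → ℂ) (x : J → ⨂[ℂ] i, H i)
    (η : ⨂[ℂ] i, H i) :
    phi1Form (∑ j ∈ s, a j • x j) η = ∑ j ∈ s, conj (a j) * phi1Form (x j) η := by
  simp [phi1Form]

variable (H) in
/-- The relation "`x i = y i` except for finitely many `i`" on families of unit vectors. -/
def unitSetoid : Setoid (∀ i, Metric.sphere (0 : H i) 1) where
  r x y := {i | x i ≠ y i}.Finite
  iseqv :=
    { refl := fun x => by simp
      symm := fun {x y} h => by simpa only [ne_comm] using h
      trans := fun {x y z} h h' => (h.union h').subset fun i hi => by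
        by_contra hc
        simp only [Set.mem_union, Set.mem_ofPred_eq, not_or, not_not] at hc
        exact hi (hc.1.trans hc.2) }

theorem posSemidef_phi1 :
    (Matrix.of fun x y : (∀ i, Metric.sphere (0 : H i) 1) =>
      phi1Fun (fun i => inner ℂ (x i : H i) (y i : H i)) :
      Matrix _ _ ℂ).PosSemidef := by
  have hs : ∀ x y : (∀ i, Metric.sphere (0 : H i) 1),
      Function.mulSupport (fun i => inner ℂ (x i : H i) (y i : H i)) = {i | x i ≠ y i} := by
    intro x y
    ext i
    have hx : ‖(x i : H i)‖ = 1 := by simp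
    have hy : ‖(y i : H i)‖ = 1 := by simp
    simp [Function.mem_mulSupport, inner_eq_one_iff_of_norm_eq_one hx hy, Subtype.ext_iff]
  refine posSemidef_kernel (I := I) (H := H) (fun x i => (x i : H i)) (unitSetoid H) _ ?_ ?_
  · intro x y h
    have h' : ¬ (Function.mulSupport (fun i => inner ℂ (x i : H i) (y i : H i))).Finite := by
      rw [hs]; exact h
    simp [phi1Fun, h']
  · intro x y h
    have h' : (Function.mulSupport (fun i => inner ℂ (x i : H i) (y i : H i))).Finite := by
      rw [hs]; exact h
    simp only [Matrix.of_apply, phi1Fun, if_pos h']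
    refine tendsto_const_nhds.congr' ?_
    filter_upwards [eventually_ge_atTop h'.toFinset] with F hF
    exact finprod_eq_prod_of_mulSupport_subset _ fun i hi => hF (by simpa using hi)

variable (H)

/-- The subspace `⨂^{un} H i` of the algebraic infinite tensor product `⨂ H i` spanned by the
elementary tensors `⨂ x i` of families of unit vectors. -/
def unSubmodule : Submodule ℂ (⨂[ℂ] i, H i) :=
  Submodule.span ℂ (Set.range fun x : (∀ i, Metric.sphere (0 : H i) 1) =>
    PiTensorProduct.tprod ℂ fun i => (x i : H i))

/-- The space `⨂^{un} H i`, to be equipped with the inner product `⟨·, ·⟩_{φ₁}`. -/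
def UnTensor : Type max u v := unSubmodule H

instance : AddCommGroup (UnTensor H) := inferInstanceAs (AddCommGroup (unSubmodule H))
instance : Module ℂ (UnTensor H) := inferInstanceAs (Module ℂ (unSubmodule H))

theorem phi1Form_self_nonneg (ξ : unSubmodule H) :
    0 ≤ phi1Form (ξ : ⨂[ℂ] i, H i) (ξ : ⨂[ℂ] i, H i) := by
  obtain ⟨ξ, hξ⟩ := ξ
  obtain ⟨c, rfl⟩ := (Finsupp.mem_span_range_iff_exists_finsupp).1 hξ
  have h := posSemidef_phi1 (H := H).2 c
  convert h using 1
  simp only [Finsupp.sum]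
  rw [phi1Form_sum_left]
  refine Finset.sum_congr rfl fun x _ => ?_
  rw [← phi1Form_conj_symm, phi1Form_sum_left, map_sum, Finset.mul_sum]
  refine Finset.sum_congr rfl fun y _ => ?_
  rw [map_mul, phi1Form_conj_symm, phi1Form_tprod, phi1_tprod]
  simp
  ring

/-- The inner product `⟨·, ·⟩_{φ₁}` on `⨂^{un} H i`. -/
@[reducible] def unCore : PreInnerProductSpace.Core ℂ (UnTensor H) where
  inner ξ η := phi1Form ξ.1 η.1
  conj_inner_symm ξ η := phi1Form_conj_symm ξ.1 η.1
  re_inner_nonneg ξ := (Complex.nonneg_iff.1 (phi1Form_self_nonneg H ξ)).1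
  add_left ξ η ζ := phi1Form_add_left ξ.1 η.1 ζ.1
  smul_left ξ η c := phi1Form_smul_left c ξ.1 η.1

instance : SeminormedAddCommGroup (UnTensor H) :=
  @InnerProductSpace.Core.toSeminormedAddCommGroup ℂ (UnTensor H) _ _ _ (unCore H)

instance : InnerProductSpace ℂ (UnTensor H) := InnerProductSpace.ofCore (unCore H)

/-- The Hilbert space `⨂̄^{φ₁} H i`: the completion of `⨂^{un} H i` with respect to
`⟨·, ·⟩_{φ₁}`. -/
abbrev Phi1Tensor : Type max u v := UniformSpace.Completion (UnTensor H)

variable {H}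

/-- The elementary tensor `⨂ x i` of a family of unit vectors, as an element of `⨂^{un} H i`. -/
def UnTensor.pure (x : ∀ i, Metric.sphere (0 : H i) 1) : UnTensor H :=
  ⟨PiTensorProduct.tprod ℂ fun i => (x i : H i), Submodule.subset_span ⟨x, rfl⟩⟩

/-- The elementary tensor `⨂ x i` of a family of unit vectors, as a vector of
`⨂̄^{φ₁} H i`. -/
def Phi1Tensor.pure (x : ∀ i, Metric.sphere (0 : H i) 1) : Phi1Tensor H :=
  ((UnTensor.pure x : UnTensor H) : UniformSpace.Completion (UnTensor H))

theorem Phi1Tensor.inner_pure (x y : ∀ i, Metric.sphere (0 : H i) 1) :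
    inner ℂ (Phi1Tensor.pure x) (Phi1Tensor.pure y) =
      phi1Fun fun i => inner ℂ (x i : H i) (y i : H i) := by
  rw [Phi1Tensor.pure, Phi1Tensor.pure, UniformSpace.Completion.inner_coe]
  exact (phi1Form_tprod H _ _).trans (phi1_tprod _)

end Phi1Tensor

/-! ### Von Neumann's infinite direct product `∏⊗ H i` -/

section VN

variable {I : Type u} (H : I → Type v) [∀ i, NormedAddCommGroup (H i)]
  [∀ i, InnerProductSpace ℂ (H i)]

/-- The `C₀`-sequences of von Neumann: families `x` with `∑ |‖x i‖ - 1| < ∞`. -/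
abbrev C0Seq : Type max u v := {x : ∀ i, H i // Summable fun i => |‖x i‖ - 1|}

variable {H}

theorem C0Seq.summable_norm_sq {H : I → Type v} [∀ i, NormedAddCommGroup (H i)]
    (x : C0Seq H) : Summable fun i => |‖x.1 i‖ ^ 2 - 1| := by
  have h := x.2
  have h2 : Summable fun i => (|‖x.1 i‖ - 1|) ^ 2 :=
    ((h.mul_of_nonneg h (fun i => abs_nonneg _) (fun i => abs_nonneg _)).comp_injective
      (i := fun i : I => (i, i)) (fun i j hij => (Prod.ext_iff.1 hij).1)).congr
      fun i => (sq _).symm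
  refine Summable.of_nonneg_of_le (fun i => abs_nonneg _) (fun i => ?_) ((h.mul_left 2).add h2)
  have : ‖x.1 i‖ ^ 2 - 1 = 2 * (‖x.1 i‖ - 1) + (‖x.1 i‖ - 1) ^ 2 := by ring
  rw [this]
  refine (abs_add_le _ _).trans ?_
  rw [abs_mul, abs_pow]
  simp

theorem C0Seq.summable_norm_sub_sq {x y : C0Seq H}
    (h : Summable fun i => ‖inner ℂ (x.1 i) (y.1 i) - 1‖) :
    Summable fun i => ‖x.1 i - y.1 i‖ ^ 2 := by
  refine Summable.of_nonneg_of_le (fun i => sq_nonneg _) (fun i => ?_)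
    ((x.summable_norm_sq.add y.summable_norm_sq).add (h.mul_left 2))
  rw [@norm_sub_sq ℂ]
  have h1 := le_abs_self (‖x.1 i‖ ^ 2 - 1)
  have h2 := le_abs_self (‖y.1 i‖ ^ 2 - 1)
  have h3 := (neg_le_abs _).trans (Complex.abs_re_le_norm (inner ℂ (x.1 i) (y.1 i) - 1))
  simp only [Complex.sub_re, Complex.one_re] at h3
  simp only [RCLike.re_to_complex]
  linarith

variable (H) in
/-- The relation `x ≈ y`, i.e. `∑ |⟨x i, y i⟩ - 1| < ∞`, on `C₀`-sequences. -/
def c0Setoid : Setoid (C0Seq H) where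
  r x y := Summable fun i => ‖inner ℂ (x.1 i) (y.1 i) - 1‖
  iseqv :=
    { refl := fun x => by
        refine x.summable_norm_sq.congr fun i => ?_
        rw [inner_self_eq_norm_sq_to_K]
        have : ((‖x.1 i‖ : ℂ) ^ 2 - 1) = ((‖x.1 i‖ ^ 2 - 1 : ℝ) : ℂ) := by push_cast; rfl
        exact ((congrArg norm this).trans (Complex.norm_real _)).symm
      symm := fun {x y} h => by
        refine h.congr fun i => ?_
        rw [← RCLike.norm_conj, map_sub, inner_conj_symm, map_one]
      trans := fun {x y z} h h' => by
        have h1 := C0Seq.summable_norm_sub_sq h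
        have h2 := C0Seq.summable_norm_sub_sq h'
        refine Summable.of_nonneg_of_le (fun i => norm_nonneg _) (fun i => ?_)
          (((h1.add h2).add (h.add h')).add y.summable_norm_sq)
        have e : inner ℂ (x.1 i) (z.1 i) - 1 =
            inner ℂ (x.1 i - y.1 i) (z.1 i - y.1 i) + (inner ℂ (x.1 i) (y.1 i) - 1) +
              (inner ℂ (y.1 i) (z.1 i) - 1) - ((‖y.1 i‖ ^ 2 - 1 : ℝ) : ℂ) := by
          have hy : ((‖y.1 i‖ ^ 2 - 1 : ℝ) : ℂ) = inner ℂ (y.1 i) (y.1 i) - 1 := by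
            rw [inner_self_eq_norm_sq_to_K]; push_cast; rfl
          rw [hy]
          simp only [inner_sub_left, inner_sub_right]
          ring
        rw [e]
        have n1 := norm_inner_le_norm (𝕜 := ℂ) (x.1 i - y.1 i) (z.1 i - y.1 i)
        rw [norm_sub_rev (z.1 i)] at n1
        have n2 : ‖((‖y.1 i‖ ^ 2 - 1 : ℝ) : ℂ)‖ = |‖y.1 i‖ ^ 2 - 1| := Complex.norm_real _
        have n3 := norm_sub_le (inner ℂ (x.1 i - y.1 i) (z.1 i - y.1 i) +
          (inner ℂ (x.1 i) (y.1 i) - 1) + (inner ℂ (y.1 i) (z.1 i) - 1))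
          ((‖y.1 i‖ ^ 2 - 1 : ℝ) : ℂ)
        have n4 := norm_add₃_le (a := inner ℂ (x.1 i - y.1 i) (z.1 i - y.1 i))
          (b := inner ℂ (x.1 i) (y.1 i) - 1) (c := inner ℂ (y.1 i) (z.1 i) - 1)
        nlinarith [sq_nonneg (‖x.1 i - y.1 i‖ - ‖y.1 i - z.1 i‖),
          sq_nonneg ‖x.1 i - y.1 i‖, sq_nonneg ‖y.1 i - z.1 i‖] }

theorem posSemidef_phi0 :
    (Matrix.of fun x y : C0Seq H => phi0Fun (fun i => inner ℂ (x.1 i) (y.1 i)) :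
      Matrix _ _ ℂ).PosSemidef := by
  refine posSemidef_kernel (I := I) (H := H) (fun x i => x.1 i) (c0Setoid H) _ ?_ ?_
  · intro x y h
    have h' : ¬ Summable fun i => ‖inner ℂ (x.1 i) (y.1 i) - 1‖ := h
    simp [phi0Fun, h']
  · intro x y h
    have h' : Summable fun i => ‖inner ℂ (x.1 i) (y.1 i) - 1‖ := h
    simp only [Matrix.of_apply, phi0Fun, if_pos h']
    exact (multipliable_of_summable_norm_sub_one h').hasProd

variable (H)

/-- Finite formal linear combinations of symbols `∏⊗ x i`, one for each `C₀`-sequence `x`. -/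
def VNPre : Type max u v := C0Seq H →₀ ℂ

instance : AddCommGroup (VNPre H) := inferInstanceAs (AddCommGroup (C0Seq H →₀ ℂ))
instance : Module ℂ (VNPre H) := inferInstanceAs (Module ℂ (C0Seq H →₀ ℂ))

variable {H} in
/-- The sesquilinear form on `VNPre H` with `⟨∏⊗ x i, ∏⊗ y i⟩ = ∏ ⟨x i, y i⟩` if `x ≈ y`, and
`= 0` otherwise. -/
def vnForm (f g : C0Seq H →₀ ℂ) : ℂ :=
  f.sum fun x a => g.sum fun y b =>
    conj a * phi0Fun (fun i => inner ℂ (x.1 i) (y.1 i)) * b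

theorem vnForm_conj_symm (f g : C0Seq H →₀ ℂ) : conj (vnForm g f) = vnForm f g := by
  simp only [vnForm, Finsupp.sum, map_sum, map_mul, ← phi0Fun_conj, inner_conj_symm,
    Complex.conj_conj]
  rw [Finset.sum_comm]
  refine Finset.sum_congr rfl fun x _ => Finset.sum_congr rfl fun y _ => ?_
  ring

/-- The inner product on `VNPre H`. -/
@[reducible] def vnCore : PreInnerProductSpace.Core ℂ (VNPre H) where
  inner f g := vnForm (H := H) f g
  conj_inner_symm f g := vnForm_conj_symm H f g
  re_inner_nonneg f := (Complex.nonneg_iff.1 (posSemidef_phi0 (H := H).2 f)).1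
  add_left f g h := by
    refine Finsupp.sum_add_index' (fun x => by simp [Finsupp.sum]) fun x a b => ?_
    simp only [map_add, add_mul, Finsupp.sum, Finset.sum_add_distrib]
  smul_left f g c := by
    refine (Finsupp.sum_smul_index (fun x => by simp [Finsupp.sum])).trans ?_
    simp only [vnForm, Finsupp.sum, Finset.mul_sum, map_mul, mul_assoc]

instance : SeminormedAddCommGroup (VNPre H) :=
  @InnerProductSpace.Core.toSeminormedAddCommGroup ℂ (VNPre H) _ _ _ (vnCore H)

instance : InnerProductSpace ℂ (VNPre H) := InnerProductSpace.ofCore (vnCore H)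

/-- Von Neumann's infinite direct product `∏⊗ H i`: the (separated) completion of the
linear combinations of the symbols `∏⊗ x i`. -/
abbrev VNProduct : Type max u v := UniformSpace.Completion (VNPre H)

variable {H}

/-- The symbol `∏⊗ x i` of a `C₀`-sequence `x`. -/
def VNPre.pure (x : C0Seq H) : VNPre H := Finsupp.single (M := ℂ) x 1

/-- The vector `∏⊗ x i` of `∏⊗ H i` given by a `C₀`-sequence `x`. -/
def VNProduct.pure (x : C0Seq H) : VNProduct H :=
  ((VNPre.pure x : VNPre H) : UniformSpace.Completion (VNPre H))

theorem VNProduct.inner_pure (x y : C0Seq H) :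
    inner ℂ (VNProduct.pure x) (VNProduct.pure y) =
      phi0Fun fun i => inner ℂ (x.1 i) (y.1 i) := by
  rw [VNProduct.pure, VNProduct.pure, UniformSpace.Completion.inner_coe]
  change vnForm (Finsupp.single x 1) (Finsupp.single y 1) = _
  simp [vnForm]

end VN

/-! ### Unitary representations -/

section Representations

variable {I : Type u} {H : I → Type v} [∀ i, NormedAddCommGroup (H i)]
  [∀ i, InnerProductSpace ℂ (H i)] [∀ i, CompleteSpace (H i)]

theorem norm_unitary_apply {E : Type v} [NormedAddCommGroup E] [InnerProductSpace ℂ E]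
    [CompleteSpace E] (U : unitary (E →L[ℂ] E)) (x : E) : ‖(U : E →L[ℂ] E) x‖ = ‖x‖ :=
  (U : E →L[ℂ] E).norm_map_of_mem_unitary U.2 x

/-- The family `(U i (x i))` of unit vectors, for unitaries `U i` and unit vectors `x i`. -/
def unitaryActSphere (U : ∀ i, unitary (H i →L[ℂ] H i)) (x : ∀ i, Metric.sphere (0 : H i) 1) :
    ∀ i, Metric.sphere (0 : H i) 1 :=
  fun i => ⟨(U i : H i →L[ℂ] H i) (x i), by simp [norm_unitary_apply]⟩

/-- The `C₀`-sequence `(U i (x i))`, for unitaries `U i` and a `C₀`-sequence `x`. -/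
def unitaryActC0 (U : ∀ i, unitary (H i →L[ℂ] H i)) (x : C0Seq H) : C0Seq H :=
  ⟨fun i => (U i : H i →L[ℂ] H i) (x.1 i), by simpa only [norm_unitary_apply] using x.2⟩

variable {G : I → Type w} [∀ i, Group (G i)]

/-- The unitary representation `ρ` of `∏ G i` on `⨂̄^{φ₁} H i` is of tensor product type:
`ρ(t) (⨂ x i) = ⨂ π i (t i) (x i)` for all families `x` of unit vectors. -/
def IsPhi1TensorRep (π : ∀ i, G i →* unitary (H i →L[ℂ] H i))
    (ρ : (∀ i, G i) →* unitary (Phi1Tensor H →L[ℂ] Phi1Tensor H)) : Prop :=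
  ∀ (t : ∀ i, G i) (x : ∀ i, Metric.sphere (0 : H i) 1),
    (ρ t : Phi1Tensor H →L[ℂ] Phi1Tensor H) (Phi1Tensor.pure x) =
      Phi1Tensor.pure (unitaryActSphere (fun i => π i (t i)) x)

/-- The unitary representation `σ` of `∏ G i` on `∏⊗ H i` is of tensor product type:
`σ(t) (∏⊗ x i) = ∏⊗ π i (t i) (x i)` for all `C₀`-sequences `x`. -/
def IsVNTensorRep (π : ∀ i, G i →* unitary (H i →L[ℂ] H i))
    (σ : (∀ i, G i) →* unitary (VNProduct H →L[ℂ] VNProduct H)) : Prop :=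
  ∀ (t : ∀ i, G i) (x : C0Seq H),
    (σ t : VNProduct H →L[ℂ] VNProduct H) (VNProduct.pure x) =
      VNProduct.pure (unitaryActC0 (fun i => π i (t i)) x)

/-- The representation of the group algebra `ℂ[Γ]` induced by a unitary representation of `Γ`,
`∑ c g • g ↦ ∑ c g • π g`. -/
def groupAlgebraRep {Γ : Type w} [Group Γ] {E : Type v} [NormedAddCommGroup E]
    [InnerProductSpace ℂ E] [CompleteSpace E] (π : Γ →* unitary (E →L[ℂ] E)) :
    MonoidAlgebra ℂ Γ →ₐ[ℂ] (E →L[ℂ] E) :=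
  MonoidAlgebra.lift ℂ (E →L[ℂ] E) Γ ((unitary (E →L[ℂ] E)).subtype.comp π)

/-- `groupAlgebraRep π` respects the involution `(c • g)^* = conj c • g⁻¹` of `ℂ[Γ]`. -/
theorem groupAlgebraRep_star {Γ : Type w} [Group Γ] {E : Type v} [NormedAddCommGroup E]
    [InnerProductSpace ℂ E] [CompleteSpace E] (π : Γ →* unitary (E →L[ℂ] E)) (g : Γ) (c : ℂ) :
    star (groupAlgebraRep π (MonoidAlgebra.single g c)) =
      groupAlgebraRep π (MonoidAlgebra.single g⁻¹ (conj c)) := by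
  simp [groupAlgebraRep, MonoidAlgebra.lift_single, ← Unitary.star_eq_inv]

end Representations

end InfTensor

end

namespace InfTensor

/-! Part (a). Each of the two Hilbert spaces has a total family of vectors with a prescribed Gram
kernel, and `∏ G i` permutes the index set. Unitaries preserve inner products coordinatewise, hence
also the kernel, so the permutation extends linearly to an isometry with dense range and then to a
unitary. Totality gives uniqueness, and uniqueness on the total family also gives the homomorphism
laws. This is `exists_unitaryRep_of_total`, applied once to each space.

Part (b). Injectivity on the group algebra means linear independence of the operators of the
representation. Given `∑ c t • ρ t = 0` over a finite set `S`, fix `t₀ ∈ S`. A complex vector space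
is not a finite union of proper subspaces, so each `H i` has a unit vector `x i` on which the
distinct operators among the `π i (t i)`, `t ∈ S`, take distinct values (`exists_unit_separating`).
Pair the relation with tensors that are `x` and `π(t₀)x` outside a finite set `F` of coordinates.
Two unit vectors have inner product 1 only when they are equal, so `φ₁` kills every `t` that differs
from `t₀` in infinitely many coordinates. If `F` contains all coordinates where the other `t` differ
from `t₀`, each surviving term is a product over `F` of freely chosen matrix coefficients. Such
products are linearly independent (`linearIndependent_coeff_sphere`, `eq_zero_of_sum_prod_eq_zero`),
so `c t₀ = 0`. -/

theorem exists_unitaryRep_of_total {Γ X K : Type*} [Group Γ] [NormedAddCommGroup K]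
    [InnerProductSpace ℂ K] [CompleteSpace K] (p : X → K)
    (hp : Dense (Submodule.span ℂ (Set.range p) : Set K)) (a : Γ →* Equiv.Perm X)
    (ha : ∀ g x y, inner ℂ (p (a g x)) (p (a g y)) = inner ℂ (p x) (p y)) :
    ∃ ρ : Γ →* unitary (K →L[ℂ] K), (∀ g x, (ρ g : K →L[ℂ] K) (p x) = p (a g x)) ∧
      ∀ ρ' : Γ →* unitary (K →L[ℂ] K),
        (∀ g x, (ρ' g : K →L[ℂ] K) (p x) = p (a g x)) → ρ' = ρ := by
  have hext : ∀ U V : unitary (K →L[ℂ] K),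
      (∀ x, (U : K →L[ℂ] K) (p x) = (V : K →L[ℂ] K) (p x)) → U = V := fun U V h =>
    Subtype.ext (ContinuousLinearMap.ext_on hp (by rintro _ ⟨x, rfl⟩; exact h x))
  have hdense : DenseRange (Finsupp.linearCombination ℂ p) := by
    rw [DenseRange, ← LinearMap.coe_range, Finsupp.range_linearCombination]
    exact hp
  -- The vectors `p x` may be linearly dependent, so the operator is first defined on formal
  -- combinations; equality of norms makes it descend to their span.
  have hnorm : ∀ g (c : X →₀ ℂ), ‖Finsupp.linearCombination ℂ p (Finsupp.domLCongr (R := ℂ) (a g) c)‖ =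
      ‖Finsupp.linearCombination ℂ p c‖ := by
    intro g c
    have h1 : Finsupp.linearCombination ℂ p (Finsupp.domLCongr (R := ℂ) (a g) c) =
        c.sum fun x r => r • p (a g x) := by
      rw [Finsupp.domLCongr_apply, Finsupp.domCongr_apply, Finsupp.equivMapDomain_eq_mapDomain,
        Finsupp.linearCombination_mapDomain, Finsupp.linearCombination_apply]
      rfl
    have h2 : inner ℂ (c.sum fun x r => r • p (a g x)) (c.sum fun x r => r • p (a g x)) =
        inner ℂ (c.sum fun x r => r • p x) (c.sum fun x r => r • p x) := by
      simp only [Finsupp.sum, sum_inner, inner_sum, inner_smul_left, inner_smul_right, ha]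
    rw [h1, Finsupp.linearCombination_apply, @norm_eq_sqrt_re_inner ℂ,
      @norm_eq_sqrt_re_inner ℂ, h2]
  have hT : ∀ g, ∃ T : K ≃ₗᵢ[ℂ] K, ∀ x, T (p x) = p (a g x) := fun g => by
    refine ⟨LinearEquiv.extendOfIsometry (Finsupp.domLCongr (R := ℂ) (M := ℂ) (a g))
      (Finsupp.linearCombination ℂ p) (Finsupp.linearCombination ℂ p) hdense hdense (hnorm g),
      fun x => ?_⟩
    have h1 : p x = Finsupp.linearCombination ℂ p (Finsupp.single x 1) := by simp
    rw [h1, LinearEquiv.extendOfIsometry_eq]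
    simp
  choose T hT using hT
  let W : Γ → unitary (K →L[ℂ] K) := fun g => Unitary.linearIsometryEquiv.symm (T g)
  have hW : ∀ g x, (W g : K →L[ℂ] K) (p x) = p (a g x) := hT
  -- The unit law, multiplicativity and uniqueness are all equalities of unitaries, checked on the
  -- total family by `hext`.
  refine ⟨⟨⟨W, hext _ _ fun x => ?_⟩, fun g h => hext _ _ fun x => ?_⟩, hW, fun ρ' h =>
    MonoidHom.ext fun g => hext _ _ fun x => ?_⟩
  · rw [hW]; simp
  · simp [hW]
  · rw [h]; exact (hW g x).symm

/-! ### Part (a): the two tensor product representations. -/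

section

variable {I : Type*} {H : I → Type*} [∀ i, NormedAddCommGroup (H i)]
  [∀ i, InnerProductSpace ℂ (H i)]

theorem dense_span_phi1Pure :
    Dense (Submodule.span ℂ (Set.range (Phi1Tensor.pure (H := H))) : Set (Phi1Tensor H)) := by
  have h : Submodule.span ℂ (Set.range (UnTensor.pure (H := H))) = ⊤ :=
    Submodule.span_range_subtype_eq_top_iff (unSubmodule H) _ |>.2 rfl
  have e : Set.range (Phi1Tensor.pure (H := H)) =
      (UniformSpace.Completion.toComplL (𝕜 := ℂ) (E := UnTensor H)).toLinearMap ''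
        Set.range UnTensor.pure := by
    rw [← Set.range_comp]; rfl
  rw [e, Submodule.span_image, h, Submodule.map_top]
  exact UniformSpace.Completion.denseRange_coe

theorem dense_span_vnPure :
    Dense (Submodule.span ℂ (Set.range (VNProduct.pure (H := H))) : Set (VNProduct H)) := by
  have h : Submodule.span ℂ (Set.range (VNPre.pure (H := H))) = ⊤ :=
    (Finsupp.basisSingleOne (R := ℂ) (ι := C0Seq H)).span_eq
  have e : Set.range (VNProduct.pure (H := H)) =
      (UniformSpace.Completion.toComplL (𝕜 := ℂ) (E := VNPre H)).toLinearMap ''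
        Set.range VNPre.pure := by
    rw [← Set.range_comp]; rfl
  rw [e, Submodule.span_image, h, Submodule.map_top]
  exact UniformSpace.Completion.denseRange_coe

variable [∀ i, CompleteSpace (H i)] {G : I → Type*} [∀ i, Group (G i)]
  (π : ∀ i, G i →* unitary (H i →L[ℂ] H i))

theorem exists_phi1TensorRep :
    ∃ ρ, IsPhi1TensorRep π ρ ∧ ∀ ρ', IsPhi1TensorRep π ρ' → ρ' = ρ := by
  -- It is enough to give an action by self-maps: since `∏ G i` is a group, `toHomPerm` turns it
  -- into an action by permutations.
  let a : (∀ i, G i) →* Function.End (∀ i, Metric.sphere (0 : H i) 1) :=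
    { toFun := fun t => unitaryActSphere fun i => π i (t i)
      map_one' := by funext x i; ext; simp [unitaryActSphere]; rfl
      map_mul' := fun s t => by funext x i; ext; simp [unitaryActSphere]; rfl }
  exact exists_unitaryRep_of_total Phi1Tensor.pure dense_span_phi1Pure a.toHomPerm fun t x y => by
    rw [Phi1Tensor.inner_pure, Phi1Tensor.inner_pure]
    exact congrArg _ (funext fun i => Unitary.inner_map_map (π i (t i)) _ _)

theorem exists_vnTensorRep :
    ∃ σ, IsVNTensorRep π σ ∧ ∀ σ', IsVNTensorRep π σ' → σ' = σ := by
  let a : (∀ i, G i) →* Function.End (C0Seq H) :=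
    { toFun := fun t => unitaryActC0 fun i => π i (t i)
      map_one' := by funext x; refine Subtype.ext ?_; funext i; simp [unitaryActC0]; rfl
      map_mul' := fun s t => by
        funext x; refine Subtype.ext ?_; funext i; simp [unitaryActC0]; rfl }
  exact exists_unitaryRep_of_total VNProduct.pure dense_span_vnPure a.toHomPerm fun t x y => by
    rw [VNProduct.inner_pure, VNProduct.inner_pure]
    exact congrArg _ (funext fun i => Unitary.inner_map_map (π i (t i)) _ _)

end

/-! ### Part (b): linear independence and injectivity on the group algebra. -/

/-- Elementary products of linearly independent functions over a finite set `F` of coordinates are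
linearly independent, over families of indices separated by `F`. -/
theorem eq_zero_of_sum_prod_eq_zero {I : Type*} {G P : I → Type*} {v : ∀ i, G i → P i → ℂ}
    (F : Finset I) (hv : ∀ i ∈ F, LinearIndependent ℂ (v i)) (S : Finset (∀ i, G i))
    (hS : ∀ s ∈ S, ∀ t ∈ S, (∀ i ∈ F, s i = t i) → s = t) (c : (∀ i, G i) → ℂ)
    (h : ∀ p : ∀ i, P i, ∑ s ∈ S, c s * ∏ i ∈ F, v i (s i) (p i) = 0) (q : ∀ i, P i) :
    ∀ s ∈ S, c s = 0 := by
  classical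
  induction F using Finset.induction_on generalizing S with
  | empty =>
    intro s hs
    -- Separation by no coordinates leaves at most one index; the point `q` serves only to evaluate
    -- the hypothesis.
    have e : S = {s} := Finset.eq_singleton_iff_unique_mem.2
      ⟨hs, fun t ht => hS t ht s hs (by simp)⟩
    simpa [e] using h q
  | insert j F hj ih =>
    intro s hs
    -- Indices with the same `j`-th coordinate as `s` are already separated by `F`, so induction
    -- applies to this fibre.
    refine ih (fun i hi => hv i (Finset.mem_insert_of_mem hi)) (S.filter fun t => t j = s j) ?_ ?_
      s (by simp [hs])
    · intro t ht u hu htu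
      rw [Finset.mem_filter] at ht hu
      refine hS t ht.1 u hu.1 fun i hi => ?_
      rcases Finset.mem_insert.1 hi with rfl | hi
      · rw [ht.2, hu.2]
      · exact htu i hi
    · intro p
      -- With `p` fixed away from `j` and the value at `j` varying, grouping terms by `t j` gives a
      -- linear relation among the `v j g`, whose coefficients are the fibre sums.
      refine linearIndependent_iff'.1 (hv j (Finset.mem_insert_self j F)) (S.image fun t => t j)
        (fun g => ∑ t ∈ S with t j = g, c t * ∏ i ∈ F, v i (t i) (p i)) ?_ (s j)
        (Finset.mem_image_of_mem _ hs)
      funext z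
      rw [Pi.zero_apply, ← h (Function.update p j z), ← Finset.sum_fiberwise_of_maps_to
        (g := fun t : ∀ i, G i => t j) (fun t ht => Finset.mem_image_of_mem (fun t => t j) ht), Finset.sum_apply]
      refine Finset.sum_congr rfl fun g _ => ?_
      rw [Pi.smul_apply, smul_eq_mul, Finset.sum_mul]
      refine Finset.sum_congr rfl fun t ht => ?_
      have e : ∏ i ∈ F, v i (t i) (Function.update p j z i) = ∏ i ∈ F, v i (t i) (p i) :=
        Finset.prod_congr rfl fun i hi => by
          rw [Function.update_of_ne (ne_of_mem_of_not_mem hi hj)]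
      rw [Finset.prod_insert hj, e, Function.update_self, (Finset.mem_filter.1 ht).2]
      ring

section

variable {Γ E : Type*} [Group Γ] [NormedAddCommGroup E] [InnerProductSpace ℂ E] [CompleteSpace E]
  {π : Γ →* unitary (E →L[ℂ] E)}

theorem groupAlgebraRep_injective_iff :
    Function.Injective (groupAlgebraRep π) ↔
      LinearIndependent ℂ fun g => (π g : E →L[ℂ] E) := by
  have e : ∀ f, groupAlgebraRep π f =
      Finsupp.linearCombination ℂ (fun g => (π g : E →L[ℂ] E)) f.coeff := fun f => by
    rw [groupAlgebraRep, MonoidAlgebra.lift_apply, Finsupp.linearCombination_apply]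
    rfl
  rw [injective_iff_map_eq_zero, linearIndependent_iff]
  constructor
  · intro h l hl
    simpa using h (.ofCoeff l) (by rw [e]; exact hl)
  · intro h f hf
    exact MonoidAlgebra.coeff_eq_zero.1 (h f.coeff (by rw [← e]; exact hf))

theorem nontrivial_of_linearIndependent (h : LinearIndependent ℂ fun g => (π g : E →L[ℂ] E)) :
    Nontrivial E := by
  by_contra hE
  rw [not_nontrivial_iff_subsingleton] at hE
  exact h.ne_zero 1 (Subsingleton.elim _ _)

/-- An operator is determined by its matrix coefficients, and by sesquilinearity those at unit
vectors suffice: nonzero vectors can be normalised, and zero vectors contribute nothing. -/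
theorem linearIndependent_coeff_sphere (h : LinearIndependent ℂ fun g => (π g : E →L[ℂ] E)) :
    LinearIndependent ℂ fun g (p : Metric.sphere (0 : E) 1 × Metric.sphere (0 : E) 1) =>
      inner ℂ (p.1 : E) ((π g : E →L[ℂ] E) p.2) := by
  rw [linearIndependent_iff'] at h ⊢
  intro s c hc
  have key : ∀ x y : E, inner ℂ y (∑ g ∈ s, c g • (π g : E →L[ℂ] E) x) = 0 := by
    intro x y
    rcases eq_or_ne x 0 with rfl | hx
    · simp
    rcases eq_or_ne y 0 with rfl | hy
    · simp
    have h1 : ∀ z : E, z ≠ 0 → ((‖z‖⁻¹ : ℝ) : ℂ) • z ∈ Metric.sphere (0 : E) 1 := fun z hz => by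
      simp [norm_smul, hz]
    have h2 := congrFun hc (⟨_, h1 y hy⟩, ⟨_, h1 x hx⟩)
    have hx' : ((‖x‖⁻¹ : ℝ) : ℂ) ≠ 0 := by simpa using hx
    have hy' : ((‖y‖⁻¹ : ℝ) : ℂ) ≠ 0 := by simpa using hy
    have h3 : ((‖y‖⁻¹ : ℝ) : ℂ) * (((‖x‖⁻¹ : ℝ) : ℂ) *
        inner ℂ y (∑ g ∈ s, c g • (π g : E →L[ℂ] E) x)) = 0 := by
      refine Eq.trans ?_ h2
      simp only [Finset.sum_apply, Pi.smul_apply, smul_eq_mul, map_smul, inner_smul_left,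
        inner_smul_right, inner_sum, Finset.mul_sum, Complex.conj_ofReal]
      exact Finset.sum_congr rfl fun g _ => by ring
    exact (mul_eq_zero.1 ((mul_eq_zero.1 h3).resolve_left hy')).resolve_left hx'
  refine h s c (ContinuousLinearMap.ext fun x => ?_)
  simpa using inner_self_eq_zero.1 (key x _)

/-- Finitely many operators of a linearly independent unitary representation are separated by one
unit vector. -/
theorem exists_unit_separating (h : LinearIndependent ℂ fun g => (π g : E →L[ℂ] E))
    (S : Finset Γ) : ∃ x : Metric.sphere (0 : E) 1, ∀ g ∈ S, ∀ k ∈ S,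
      (π g : E →L[ℂ] E) x = (π k : E →L[ℂ] E) x → g = k := by
  classical
  have := nontrivial_of_linearIndependent h
  let K : Γ × Γ → Submodule ℂ E := fun q =>
    ((π q.1 : E →L[ℂ] E) - (π q.2 : E →L[ℂ] E)).toLinearMap.ker
  -- Each kernel is proper because independent operators are distinct. Adjoining `⊥`, proper since
  -- `E` is nontrivial, makes the vector found below nonzero.
  have htop : ⊤ ∉ insert ⊥ (S.offDiag.image K) := by
    simp only [Finset.mem_insert, top_ne_bot, Finset.mem_image, false_or, not_exists, not_and]
    intro q hq e
    refine (Finset.mem_offDiag.1 hq).2.2 (h.injective (ContinuousLinearMap.ext fun x => ?_))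
    have hx : x ∈ K q := e ▸ Submodule.mem_top
    simpa [K, sub_eq_zero] using hx
  obtain ⟨x, hx⟩ := (Set.ne_univ_iff_exists_notMem _).1
    (Subspace.biUnion_ne_univ_of_top_notMem htop)
  simp only [Set.mem_iUnion, not_exists, SetLike.mem_coe] at hx
  have hx0 : x ≠ 0 := by simpa using hx ⊥ (Finset.mem_insert_self _ _)
  have hc : ((‖x‖⁻¹ : ℝ) : ℂ) ≠ 0 := by simpa using hx0
  refine ⟨⟨((‖x‖⁻¹ : ℝ) : ℂ) • x, by simp [norm_smul, hx0]⟩, fun g hg k hk e => ?_⟩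
  by_contra hgk
  refine hx (K (g, k)) (Finset.mem_insert_of_mem (Finset.mem_image_of_mem _
    (Finset.mem_offDiag.2 ⟨hg, hk, hgk⟩))) ?_
  have e' : (π g : E →L[ℂ] E) x = (π k : E →L[ℂ] E) x := by
    simp only [map_smul] at e
    exact smul_right_injective E hc e
  simp [K, e']

end

theorem linearIndependent_phi1TensorRep {I : Type*} {H : I → Type*}
    [∀ i, NormedAddCommGroup (H i)] [∀ i, InnerProductSpace ℂ (H i)] [∀ i, CompleteSpace (H i)]
    {G : I → Type*} [∀ i, Group (G i)] {π : ∀ i, G i →* unitary (H i →L[ℂ] H i)}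
    {ρ : (∀ i, G i) →* unitary (Phi1Tensor H →L[ℂ] Phi1Tensor H)} (hρ : IsPhi1TensorRep π ρ)
    (h : ∀ i, LinearIndependent ℂ fun g => (π i g : H i →L[ℂ] H i)) :
    LinearIndependent ℂ fun t => (ρ t : Phi1Tensor H →L[ℂ] Phi1Tensor H) := by
  classical
  rw [linearIndependent_iff']
  intro S c hc t₀ ht₀
  choose x hx using fun i => exists_unit_separating (h i) (S.image fun t => t i)
  have hsum : ∀ z y : ∀ i, Metric.sphere (0 : H i) 1,
      ∑ t ∈ S, c t * phi1Fun (fun i => inner ℂ (y i : H i) ((π i (t i) : H i →L[ℂ] H i) (z i))) =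
        0 := by
    intro z y
    have h1 : inner ℂ (Phi1Tensor.pure y) ((∑ t ∈ S, c t •
        (ρ t : Phi1Tensor H →L[ℂ] Phi1Tensor H)) (Phi1Tensor.pure z)) = 0 := by
      rw [hc]; simp
    simp only [sum_apply, smul_apply, inner_sum,
      inner_smul_right, hρ _ z, Phi1Tensor.inner_pure] at h1
    exact h1
  let D : (∀ i, G i) → Set I := fun t => {i | t i ≠ t₀ i}
  -- `R` consists of the indices that will survive `φ₁`; the finite set `F` below contains every
  -- coordinate where some member of `R` differs from `t₀`.
  let R := S.filter fun t => (D t).Finite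
  have hfin : (⋃ t ∈ R, D t).Finite :=
    R.finite_toSet.biUnion fun t ht => (Finset.mem_filter.1 ht).2
  let F := hfin.toFinset
  have hF : ∀ t ∈ R, ∀ i ∉ F, t i = t₀ i := by
    intro t ht i hi
    by_contra hne
    exact hi (hfin.mem_toFinset.2 (Set.mem_biUnion ht hne))
  -- The family `(x i, x i)` only witnesses that the parameter spaces are inhabited.
  refine eq_zero_of_sum_prod_eq_zero
    (v := fun i g (p : Metric.sphere (0 : H i) 1 × Metric.sphere (0 : H i) 1) =>
      inner ℂ (p.1 : H i) ((π i g : H i →L[ℂ] H i) p.2)) F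
    (fun i _ => linearIndependent_coeff_sphere (h i)) R ?_ c ?_ (fun i => (x i, x i)) t₀
    (Finset.mem_filter.2 ⟨ht₀, by simp [D]⟩)
  · intro s hs t ht hst
    funext i
    by_cases hi : i ∈ F
    · exact hst i hi
    · rw [hF s hs i hi, hF t ht i hi]
  · intro p
    -- The test vectors are arbitrary on `F`. Off `F` they are chosen so that the factor at `i`
    -- equals 1 exactly when `t i = t₀ i`; this is where the separating property of `x` enters.
    let z : ∀ i, Metric.sphere (0 : H i) 1 := fun i => if i ∈ F then (p i).2 else x i
    let y : ∀ i, Metric.sphere (0 : H i) 1 := fun i =>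
      if i ∈ F then (p i).1 else unitaryActSphere (fun i => π i (t₀ i)) x i
    have hout : ∀ (t : ∀ i, G i) (i : I), i ∉ F →
        inner ℂ (y i : H i) ((π i (t i) : H i →L[ℂ] H i) (z i)) =
          inner ℂ ((π i (t₀ i) : H i →L[ℂ] H i) (x i)) ((π i (t i) : H i →L[ℂ] H i) (x i)) := by
      intro t i hi
      simp [y, z, hi, unitaryActSphere]
    have hone : ∀ t ∈ S, ∀ i ∉ F,
        inner ℂ (y i : H i) ((π i (t i) : H i →L[ℂ] H i) (z i)) = 1 ↔ t i = t₀ i := by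
      intro t ht i hi
      rw [hout t i hi, inner_eq_one_iff_of_norm_eq_one (by simp [norm_unitary_apply])
        (by simp [norm_unitary_apply])]
      refine ⟨fun e => (hx i _ (Finset.mem_image_of_mem _ ht₀) _
        (Finset.mem_image_of_mem _ ht) e).symm, fun e => by rw [e]⟩
    rw [← hsum z y, Finset.sum_filter]
    refine Finset.sum_congr rfl fun t ht => ?_
    split_ifs with hD
    · have hR : t ∈ R := Finset.mem_filter.2 ⟨ht, hD⟩
      have hsub : Function.mulSupport (fun i =>
          inner ℂ (y i : H i) ((π i (t i) : H i →L[ℂ] H i) (z i))) ⊆ F := by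
        intro i hi
        by_contra hiF
        exact hi ((hone t ht i hiF).2 (hF t hR i hiF))
      rw [phi1Fun, if_pos (F.finite_toSet.subset hsub),
        finprod_eq_prod_of_mulSupport_subset _ hsub]
      congr 1
      exact Finset.prod_congr rfl fun i hi => by simp [y, z, hi]
    -- Were only finitely many factors different from 1, `t` would differ from `t₀` only at those
    -- coordinates or in `F`, hence finitely often.
    · rw [phi1Fun, if_neg, mul_zero]
      intro hm
      refine hD ((hm.union F.finite_toSet).subset fun i hi => ?_)
      by_cases hiF : i ∈ F
      · exact Or.inr hiF
      · exact Or.inl fun e => hi ((hone t ht i hiF).1 e)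

end InfTensor

theorem mainTheorem9 {I : Type*} {H : I → Type*} [∀ i, NormedAddCommGroup (H i)]
    [∀ i, InnerProductSpace ℂ (H i)] [∀ i, CompleteSpace (H i)]
    {G : I → Type*} [∀ i, Group (G i)] (π : ∀ i, G i →* unitary (H i →L[ℂ] H i)) :
    ∃ (ρ : (∀ i, G i) →*
          unitary (InfTensor.Phi1Tensor H →L[ℂ] InfTensor.Phi1Tensor H))
      (σ : (∀ i, G i) →*
          unitary (InfTensor.VNProduct H →L[ℂ] InfTensor.VNProduct H)),
      (InfTensor.IsPhi1TensorRep π ρ ∧ ∀ ρ', InfTensor.IsPhi1TensorRep π ρ' → ρ' = ρ) ∧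
      (InfTensor.IsVNTensorRep π σ ∧ ∀ σ', InfTensor.IsVNTensorRep π σ' → σ' = σ) ∧
      ((∀ i, Function.Injective (InfTensor.groupAlgebraRep (π i))) →
        Function.Injective (InfTensor.groupAlgebraRep ρ)) := by
  obtain ⟨ρ, hρ⟩ := InfTensor.exists_phi1TensorRep π
  obtain ⟨σ, hσ⟩ := InfTensor.exists_vnTensorRep π
  refine ⟨ρ, σ, hρ, hσ, fun h => ?_⟩
  exact InfTensor.groupAlgebraRep_injective_iff.2
    (InfTensor.linearIndependent_phi1TensorRep hρ.1
      fun i => InfTensor.groupAlgebraRep_injective_iff.1 (h i))
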